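/- Let $\mathcal M\subseteq\mathcal B(\mathcal H)$ and $\mathcal N\subseteq\mathcal B(\mathcal K)$ be two matrix algebras, i.e. unital subalgebras closed under adjoints, where $\mathcal H,\mathcal K$ are finite-dimensional complex Hilbert spaces. Let $\sigma,\rho\in\mathcal M$ be two positive definite quantum states (trace one). Let $\mathcal T:\mathcal M\to\mathcal N$ be a quantum channel, i.e. a completely positive trace-preserving linear map, and let $V:\mathcal H\to\mathcal K\otimes\mathcal V$, with $\mathcal V$ a finite-dimensional Hilbert space, be the isometry of a Stinespring dilation of $\mathcal T$, i.e. $V^*V=I$ and $\mathcal T(\omega)=\operatorname{tr}_{\mathcal V}[V\omega V^*]$ for all states $\omega\in\mathcal M$. Write $\sigma_{\mathcal T}=\mathcal T(\sigma)$, $\rho_{\mathcal T}=\mathcal T(\rho)$, $\Gamma=\sigma^{-1/2}\rho\,\sigma^{-1/2}$, $\Gamma_{\mathcal T}=\sigma_{\mathcal T}^{-1/2}\rho_{\mathcal T}\,\sigma_{\mathcal T}^{-1/2}$, and let $\mathcal T^*:\mathcal N\to\mathcal M$ be the adjoint of $\mathcal T$ for the Hilbert–Schmidt inner products $\langle A,B\rangle=\operatorname{tr}[A^*B]$.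 Let $\hat S_{\mathrm{BS}}(\sigma\|\rho)=\operatorname{tr}[\sigma\log(\sigma^{1/2}\rho^{-1}\sigma^{1/2})]$ be the Belavkin–Staszewski (BS) entropy, where for singular arguments the value is $+\infty$ unless the support of the first argument is contained in that of the second, and $0\log 0=0$. If $\sigma_{\mathcal T}$ or $\rho_{\mathcal T}$ is not invertible, its negative powers are taken on its support (Moore–Penrose). Then the following three conditions are equivalent: 1. $\hat S_{\mathrm{BS}}(\sigma\|\rho)=\hat S_{\mathrm{BS}}(\sigma_{\mathcal T}\|\rho_{\mathcal T})$; 2. $\sigma^{-1}\rho=\mathcal T^*\left(\sigma_{\mathcal T}^{-1}\rho_{\mathcal T}\right)$; 3. $V\sigma^{1/2}V^*\left(\sigma_{\mathcal T}^{-1/2}\,\Gamma_{\mathcal T}^{1/2}\,\sigma_{\mathcal T}^{1/2}\otimes I\right)=V\,\Gamma^{1/2}\sigma^{1/2}\,V^*$. -/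

import Mathlib

open scoped Kronecker Matrix ComplexOrder

namespace BSEntropy

noncomputable section

/-- A matrix algebra on the Hilbert space `ℂ^n`: a unital subalgebra of `B(ℂ^n)` which is closed
under taking adjoints. -/
abbrev MatrixAlgebra (n : Type*) [Fintype n] [DecidableEq n] := StarSubalgebra ℂ (Matrix n n ℂ)

/-- Density matrices: positive semidefinite matrices of trace one. -/
def IsState {n : Type*} [Fintype n] (ω : Matrix n n ℂ) : Prop :=
  ω.PosSemidef ∧ ω.trace = 1

/-- The real power `A ^ p` (`p ≠ 0`) of a positive semidefinite matrix by functional calculus.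
Since `0 ^ p = 0` in `ℝ` for `p ≠ 0`, negative powers are taken on the support of `A`
(Moore-Penrose); for positive definite `A` they are the usual ones. -/
def psdPow {n : Type*} [Fintype n] [DecidableEq n] (A : Matrix n n ℂ) (p : ℝ) : Matrix n n ℂ :=
  cfc (fun x : ℝ => x ^ p) A

theorem psdPow_mem {n : Type*} [Fintype n] [DecidableEq n] (M : MatrixAlgebra n) (A : M) (p : ℝ) :
    psdPow (A : Matrix n n ℂ) p ∈ M := by
  have hc : IsClosed (M : Set (Matrix n n ℂ)) :=
    Submodule.closed_of_finiteDimensional (M.toSubalgebra.toSubmodule)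
  exact cfc_mem (𝕜' := ℂ) (hs := hc) _ A.2

/-- The power `A ^ p` as an element of the matrix algebra that contains `A`. -/
def algPow {n : Type*} [Fintype n] [DecidableEq n] {M : MatrixAlgebra n} (A : M) (p : ℝ) : M :=
  ⟨psdPow (A : Matrix n n ℂ) p, psdPow_mem M A p⟩

/-- `Γ(σ, ρ) = σ^{-1/2} ρ σ^{-1/2}`. -/
def gam {n : Type*} [Fintype n] [DecidableEq n] (σ ρ : Matrix n n ℂ) : Matrix n n ℂ :=
  psdPow σ (-1 / 2) * ρ * psdPow σ (-1 / 2)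

open Classical in
/-- The Belavkin-Staszewski relative entropy
`tr[σ log (σ^{1/2} ρ^{-1} σ^{1/2})]`, which is `+∞` unless the support of `σ` is contained in
that of `ρ`. For singular matrices the inverse is taken on the support, and `0 log 0 = 0`. -/
def bsEntropy {n : Type*} [Fintype n] [DecidableEq n] (σ ρ : Matrix n n ℂ) : EReal :=
  if ∀ x : n → ℂ, ρ *ᵥ x = 0 → σ *ᵥ x = 0 then
    (((σ * cfc Real.log (psdPow σ (1 / 2) * psdPow ρ (-1) * psdPow σ (1 / 2))).trace.re : ℝ) :
      EReal)
  else ⊤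

/-- An `r × r` matrix over the matrix algebra `M`, that is, an element of `M ⊗ M_r(ℂ)`,
as a complex matrix on `ℂ^n ⊗ ℂ^r`. -/
def blockMatrix {n : Type*} [Fintype n] [DecidableEq n] {M : MatrixAlgebra n} {r : ℕ}
    (A : Matrix (Fin r) (Fin r) M) : Matrix (n × Fin r) (n × Fin r) ℂ :=
  Matrix.of fun i j => (A i.2 j.2 : Matrix n n ℂ) i.1 j.1

/-- `T ⊗ Id_r` maps positive elements of `M ⊗ M_r(ℂ)` to positive elements, for every `r`. -/
def IsCompletelyPositive {m k : Type*} [Fintype m] [DecidableEq m] [Fintype k] [DecidableEq k]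
    {M : MatrixAlgebra m} {N : MatrixAlgebra k} (T : M →ₗ[ℂ] N) : Prop :=
  ∀ (r : ℕ) (A : Matrix (Fin r) (Fin r) M),
    (blockMatrix A).PosSemidef → (blockMatrix (A.map T)).PosSemidef

/-- Quantum channels: completely positive trace-preserving maps. -/
def IsQuantumChannel {m k : Type*} [Fintype m] [DecidableEq m] [Fintype k] [DecidableEq k]
    {M : MatrixAlgebra m} {N : MatrixAlgebra k} (T : M →ₗ[ℂ] N) : Prop :=
  IsCompletelyPositive T ∧
    ∀ A : M, (T A : Matrix k k ℂ).trace = (A : Matrix m m ℂ).trace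

/-- Partial trace over the second tensor factor. -/
def partialTrace {k v : Type*} [Fintype v] (A : Matrix (k × v) (k × v) ℂ) : Matrix k k ℂ :=
  Matrix.of fun i j => ∑ a, A (i, a) (j, a)

/-- `V : ℂ^m → ℂ^k ⊗ ℂ^v` is the isometry of a Stinespring dilation of `T`:
`T(ω) = tr_v [V ω V*]` for all states `ω` in `M`. -/
def IsStinespringIsometry {m k v : Type*} [Fintype m] [DecidableEq m] [Fintype k] [DecidableEq k]
    [Fintype v] {M : MatrixAlgebra m} {N : MatrixAlgebra k} (T : M →ₗ[ℂ] N)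
    (V : Matrix (k × v) m ℂ) : Prop :=
  Vᴴ * V = 1 ∧
    ∀ ω : M, IsState (ω : Matrix m m ℂ) →
      (T ω : Matrix k k ℂ) = partialTrace (V * (ω : Matrix m m ℂ) * Vᴴ)

/-- Matrices as vectors of a Euclidean space, whose inner product is the Hilbert-Schmidt one. -/
def vecEquiv (n : Type*) [Fintype n] : Matrix n n ℂ ≃ₗ[ℂ] EuclideanSpace ℂ (n × n) where
  toFun A := WithLp.toLp 2 fun p => A p.1 p.2
  invFun x := Matrix.of fun i j => x (i, j)
  map_add' _ _ := rfl
  map_smul' _ _ := rfl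
  left_inv _ := rfl
  right_inv _ := rfl

theorem inner_vecEquiv {n : Type*} [Fintype n] (A B : Matrix n n ℂ) :
    inner ℂ (vecEquiv n A) (vecEquiv n B) = (Aᴴ * B).trace := by
  rw [PiLp.inner_apply, Fintype.sum_prod_type_right]
  simp only [Matrix.trace, Matrix.diag_apply, Matrix.mul_apply, Matrix.conjTranspose_apply]
  refine Finset.sum_congr rfl fun i _ => Finset.sum_congr rfl fun j _ => ?_
  exact mul_comm (B j i) (star (A j i))

/-- Every linear map between matrix algebras has an adjoint with respect to the Hilbert-Schmidt
inner products `⟨A, B⟩ = tr[A* B]`. -/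
theorem exists_hsAdjoint {m k : Type*} [Fintype m] [DecidableEq m] [Fintype k] [DecidableEq k]
    {M : MatrixAlgebra m} {N : MatrixAlgebra k} (T : M →ₗ[ℂ] N) :
    ∃! S : N →ₗ[ℂ] M, ∀ (Y : N) (X : M),
      ((S Y : Matrix m m ℂ)ᴴ * (X : Matrix m m ℂ)).trace =
        ((Y : Matrix k k ℂ)ᴴ * (T X : Matrix k k ℂ)).trace := by
  let M' : Submodule ℂ (Matrix m m ℂ) := M.toSubalgebra.toSubmodule
  let N' : Submodule ℂ (Matrix k k ℂ) := N.toSubalgebra.toSubmodule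
  let EM : Submodule ℂ (EuclideanSpace ℂ (m × m)) := M'.map (vecEquiv m : _ →ₗ[ℂ] _)
  let EN : Submodule ℂ (EuclideanSpace ℂ (k × k)) := N'.map (vecEquiv k : _ →ₗ[ℂ] _)
  let eM : M ≃ₗ[ℂ] EM := (vecEquiv m).submoduleMap M'
  let eN : N ≃ₗ[ℂ] EN := (vecEquiv k).submoduleMap N'
  let T' : EM →ₗ[ℂ] EN := (eN.toLinearMap ∘ₗ T) ∘ₗ eM.symm.toLinearMap
  let R : EN →ₗ[ℂ] EM := LinearMap.adjoint (𝕜 := ℂ) (E := EM) (F := EN) T'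
  let S : N →ₗ[ℂ] M := (eM.symm.toLinearMap ∘ₗ R) ∘ₗ eN.toLinearMap
  have hS : ∀ (Y : N) (X : M), ((S Y : Matrix m m ℂ)ᴴ * (X : Matrix m m ℂ)).trace =
      ((Y : Matrix k k ℂ)ᴴ * (T X : Matrix k k ℂ)).trace := by
    intro Y X
    have h := LinearMap.adjoint_inner_left (𝕜 := ℂ) (E := EM) (F := EN) T' (eM X) (eN Y)
    have h1 : R (eN Y) = eM (S Y) := by simp [S, R]
    have h2 : T' (eM X) = eN (T X) := by simp [T']
    change inner ℂ (R (eN Y)) (eM X) = inner ℂ (eN Y) (T' (eM X)) at h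
    rw [h1, h2, Submodule.coe_inner, Submodule.coe_inner] at h
    rw [← inner_vecEquiv, ← inner_vecEquiv]
    exact h
  refine ⟨S, hS, fun S' hS' => LinearMap.ext fun Y => Subtype.ext ?_⟩
  have h : ∀ X : M, (((S' Y - S Y : M) : Matrix m m ℂ)ᴴ * (X : Matrix m m ℂ)).trace = 0 := by
    intro X
    have h1 := (hS' Y X).trans (hS Y X).symm
    simp only [AddSubgroupClass.coe_sub, Matrix.conjTranspose_sub, Matrix.sub_mul,
      Matrix.trace_sub]
    exact sub_eq_zero.2 h1
  have h0 := Matrix.trace_conjTranspose_mul_self_eq_zero_iff.1 (h (S' Y - S Y))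
  exact sub_eq_zero.1 (by simpa using h0)

/-- The adjoint `T*` with respect to the Hilbert-Schmidt inner products. -/
def hsAdjoint {m k : Type*} [Fintype m] [DecidableEq m] [Fintype k] [DecidableEq k]
    {M : MatrixAlgebra m} {N : MatrixAlgebra k} (T : M →ₗ[ℂ] N) : N →ₗ[ℂ] M :=
  (exists_hsAdjoint T).choose

theorem hsAdjoint_spec {m k : Type*} [Fintype m] [DecidableEq m] [Fintype k] [DecidableEq k]
    {M : MatrixAlgebra m} {N : MatrixAlgebra k} (T : M →ₗ[ℂ] N) (Y : N) (X : M) :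
    ((hsAdjoint T Y : Matrix m m ℂ)ᴴ * (X : Matrix m m ℂ)).trace =
      ((Y : Matrix k k ℂ)ᴴ * (T X : Matrix k k ℂ)).trace :=
  (exists_hsAdjoint T).choose_spec.1 Y X

end

end BSEntropy

/-! Write τ, θ for the images of σ, ρ, and G for `gam τ θ`, Γ for `gam σ ρ`. With D = σ^{1/2} V*
(τ^{-1/2} ⊗ 1), the completely positive map X ↦ tr_v[D* X D] sends 1 to the support projection of τ,
sends Γ to G, and carries the weight σ to τ. All three conditions turn out to be equivalent to the
single relation Γ D = D (G ⊗ 1), called `Intertwines`.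

The BS entropy is -tr[σ log Γ]. For resolvents R of Γ and S of G at s > 0, the difference tr[σR] -
tr[τS] is a nonnegative quadratic form in R D - D (S ⊗ 1) (`trace_resolvent_defect`). It is also the
s-derivative of tr[σ log(Γ + s)] - tr[τ log(G + s)], which tends to 0 at infinity and, when the
entropies agree, vanishes at 0. So the defect is zero, and D intertwines the resolvents, hence Γ and
G. Conversely, intertwining passes to the logarithm.

Condition 2, paired with ρ, says tr[σΓ²] = tr[τG²], and the same quadratic form with (Γ, G) in place
of (R, S) forces intertwining (`intertwines_of_trace_eq`). Condition 3 is the intertwining of the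
square roots, multiplied by V on the left and by τ^{1/2} ⊗ 1 on the right (`intertwines_iff_sqrt`).
-/

namespace BSEntropy

/-! ### From equal logarithmic sums to equal resolvent sums. -/

section LogComparison

open Filter Topology

/-- If the resolvent sums of two weighted families are ordered at every positive parameter and
their logarithmic sums agree, then the resolvent sums agree. -/
theorem sum_inv_eq_of_sum_log_eq {ι κ : Type*} [Fintype ι] [Fintype κ] {p a : ι → ℝ}
    {q b : κ → ℝ} (ha : ∀ i, 0 ≤ a i) (hb : ∀ j, 0 ≤ b j) (hpa : ∀ i, a i = 0 → p i = 0)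
    (hqb : ∀ j, b j = 0 → q j = 0) (hsum : ∑ i, p i = ∑ j, q j)
    (hlog : ∑ i, p i * Real.log (a i) = ∑ j, q j * Real.log (b j))
    (hle : ∀ s : ℝ, 0 < s → ∑ j, q j * (b j + s)⁻¹ ≤ ∑ i, p i * (a i + s)⁻¹)
    {s : ℝ} (hs : 0 < s) : ∑ i, p i * (a i + s)⁻¹ = ∑ j, q j * (b j + s)⁻¹ := by
  set F : ℝ → ℝ := fun s => ∑ i, p i * Real.log (a i + s) - ∑ j, q j * Real.log (b j + s) with hF
  -- Continuity at the endpoint 0 survives terms with `a i = 0` or `b j = 0`, because their weights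
  -- vanish.
  have hcont : ContinuousOn F (Set.Ici 0) := by
    have haux : ∀ c w : ℝ, 0 ≤ c → (c = 0 → w = 0) →
        ContinuousOn (fun s => w * Real.log (c + s)) (Set.Ici 0) := by
      intro c w hc hcw
      rcases hc.eq_or_lt with h | h
      · simp only [hcw h.symm, zero_mul]
        exact continuousOn_const
      · refine continuousOn_const.mul (ContinuousOn.log (by fun_prop) fun x hx => ?_)
        have : (0 : ℝ) ≤ x := hx
        positivity
    exact (continuousOn_finsetSum _ fun i _ => haux _ _ (ha i) (hpa i)).sub
      (continuousOn_finsetSum _ fun j _ => haux _ _ (hb j) (hqb j))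
  have hderiv : ∀ s : ℝ, 0 < s →
      HasDerivAt F (∑ i, p i * (a i + s)⁻¹ - ∑ j, q j * (b j + s)⁻¹) s := by
    intro s hs
    have haux : ∀ c w : ℝ, 0 ≤ c →
        HasDerivAt (fun s => w * Real.log (c + s)) (w * (c + s)⁻¹) s := by
      intro c w hc
      have h := ((hasDerivAt_id s).const_add c).log (by simp only [id]; positivity)
      simpa using h.const_mul w
    exact (HasDerivAt.fun_sum fun i _ => haux _ _ (ha i)).sub
      (HasDerivAt.fun_sum fun j _ => haux _ _ (hb j))
  have hmono : MonotoneOn F (Set.Ici 0) := by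
    refine monotoneOn_of_deriv_nonneg (convex_Ici 0) hcont ?_ ?_
    · intro x hx
      rw [interior_Ici] at hx
      exact (hderiv x hx).differentiableAt.differentiableWithinAt
    · intro x hx
      rw [interior_Ici] at hx
      rw [(hderiv x hx).deriv]
      exact sub_nonneg.2 (hle x hx)
  -- Equal total weights allow `log s` to be subtracted from every term, and each difference then
  -- tends to 0.
  have hlim : Tendsto F atTop (𝓝 0) := by
    have h1 : F = fun s => ∑ i, p i * (Real.log (s + a i) - Real.log s) -
        ∑ j, q j * (Real.log (s + b j) - Real.log s) := by
      funext s
      simp only [hF, mul_sub, Finset.sum_sub_distrib, ← Finset.sum_mul, hsum, add_comm s]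
      ring
    have haux : ∀ c w : ℝ, Tendsto (fun s => w * (Real.log (s + c) - Real.log s)) atTop (𝓝 0) := by
      intro c w
      simpa using (Real.tendsto_log_comp_add_sub_log c).const_mul w
    rw [h1]
    simpa using (tendsto_finsetSum Finset.univ fun i _ => haux (a i) (p i)).sub
      (tendsto_finsetSum Finset.univ fun j _ => haux (b j) (q j))
  have h0 : F 0 = 0 := by simp [hF, hlog]
  -- A nondecreasing function that starts at 0 and tends to 0 is constant.
  have hzero : ∀ t : ℝ, 0 ≤ t → F t = 0 := by
    intro t ht
    refine le_antisymm (ge_of_tendsto hlim ?_) (h0 ▸ hmono Set.self_mem_Ici ht ht)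
    filter_upwards [eventually_ge_atTop t] with u hu
    exact hmono ht (ht.trans hu) hu
  have hev : F =ᶠ[𝓝 s] fun _ => 0 := by
    filter_upwards [lt_mem_nhds hs] with t ht
    exact hzero t ht.le
  have := (hderiv s hs).unique ((hasDerivAt_const s (0 : ℝ)).congr_of_eventuallyEq hev)
  exact sub_eq_zero.1 this

end LogComparison

open Matrix

/-! ### Functional calculus for Hermitian matrices; powers and supports. -/

section FunctionalCalculus

variable {n : Type*} [Fintype n] [DecidableEq n]

theorem continuousOn_spectrum (A : Matrix n n ℂ) (f : ℝ → ℝ) : ContinuousOn f (spectrum ℝ A) :=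
  A.finite_real_spectrum.continuousOn f

/-- Spectral theorem, phrased through the functional calculus. -/
theorem exists_diagonalization {A : Matrix n n ℂ} (hA : A.IsHermitian) :
    ∃ (U : Matrix n n ℂ) (a : n → ℝ), Uᴴ * U = 1 ∧ U * Uᴴ = 1 ∧ (∀ i, a i ∈ spectrum ℝ A) ∧
      ∀ f : ℝ → ℝ, cfc f A = U * diagonal (fun i => (f (a i) : ℂ)) * Uᴴ := by
  refine ⟨hA.eigenvectorUnitary, hA.eigenvalues, ?_, ?_, hA.eigenvalues_mem_spectrum_real, ?_⟩
  · exact Unitary.coe_star_mul_self hA.eigenvectorUnitary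
  · exact Unitary.coe_mul_star_self hA.eigenvectorUnitary
  · intro f
    rw [hA.cfc_eq, IsHermitian.cfc, Unitary.conjStarAlgAut_apply]
    rfl

theorem spectrum_nonneg {A : Matrix n n ℂ} (hA : A.PosSemidef) {x : ℝ} (hx : x ∈ spectrum ℝ A) :
    0 ≤ x := by
  rw [hA.1.spectrum_real_eq_range_eigenvalues] at hx
  obtain ⟨i, rfl⟩ := hx
  exact hA.eigenvalues_nonneg i

theorem spectrum_pos {A : Matrix n n ℂ} (hA : A.PosDef) {x : ℝ} (hx : x ∈ spectrum ℝ A) :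
    0 < x := by
  rw [hA.1.spectrum_real_eq_range_eigenvalues] at hx
  obtain ⟨i, rfl⟩ := hx
  exact hA.eigenvalues_pos i

theorem cfc_isHermitian (A : Matrix n n ℂ) (f : ℝ → ℝ) : (cfc f A).IsHermitian :=
  cfc_predicate f A

theorem cfc_mul_eq {A : Matrix n n ℂ} (hA : A.PosSemidef) {f g e : ℝ → ℝ}
    (h : ∀ x, 0 ≤ x → f x * g x = e x) : cfc f A * cfc g A = cfc e A := by
  rw [← cfc_mul f g A (continuousOn_spectrum A f) (continuousOn_spectrum A g)]
  exact cfc_congr fun x hx => h x (spectrum_nonneg hA hx)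

theorem cfc_commute (A : Matrix n n ℂ) (f g : ℝ → ℝ) : cfc f A * cfc g A = cfc g A * cfc f A := by
  rw [← cfc_mul f g A (continuousOn_spectrum A f) (continuousOn_spectrum A g),
    ← cfc_mul g f A (continuousOn_spectrum A g) (continuousOn_spectrum A f)]
  simp only [mul_comm]

theorem cfc_id_eq {A : Matrix n n ℂ} (hA : A.IsHermitian) : cfc (fun x : ℝ => x) A = A :=
  cfc_id' ℝ A hA

/-- In eigenbases of `A` and `B` the hypothesis reads (a_i - b_j) x_ij = 0, so `X` connects only
equal eigenvalues, at which `f` takes equal values. -/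
theorem cfc_mul_of_intertwine {n' : Type*} [Fintype n'] [DecidableEq n'] {A : Matrix n n ℂ}
    {B : Matrix n' n' ℂ} (hA : A.IsHermitian) (hB : B.IsHermitian) {X : Matrix n n' ℂ}
    (h : A * X = X * B) (f : ℝ → ℝ) : cfc f A * X = X * cfc f B := by
  obtain ⟨U, a, hU, hU', -, hf⟩ := exists_diagonalization hA
  obtain ⟨W, b, hW, hW', -, hg⟩ := exists_diagonalization hB
  have key : ∀ e : ℝ → ℝ, cfc e A * X = X * cfc e B ↔
      diagonal (fun i => (e (a i) : ℂ)) * (Uᴴ * X * W) =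
        (Uᴴ * X * W) * diagonal (fun i => (e (b i) : ℂ)) := by
    intro e
    rw [hf, hg]
    constructor
    · intro h1
      have h2 := congrArg (fun Z => Uᴴ * Z * W) h1
      simp only [Matrix.mul_assoc, hW, Matrix.mul_one] at h2
      simp only [← Matrix.mul_assoc, hU, Matrix.one_mul] at h2
      simpa only [Matrix.mul_assoc] using h2
    · intro h1
      have h2 := congrArg (fun Z => U * Z * Wᴴ) h1
      simp only [Matrix.mul_assoc, hW', Matrix.mul_one] at h2
      simp only [← Matrix.mul_assoc, hU', Matrix.one_mul] at h2
      simpa only [Matrix.mul_assoc] using h2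
  have h0 : cfc (fun x : ℝ => x) A * X = X * cfc (fun x : ℝ => x) B := by
    rw [cfc_id_eq hA, cfc_id_eq hB, h]
  rw [key] at h0 ⊢
  ext i j
  have hij := congrFun (congrFun h0 i) j
  rw [diagonal_mul, mul_diagonal] at hij ⊢
  by_cases hab : a i = b j
  · rw [hab, mul_comm]
  · have : (Uᴴ * X * W) i j = 0 := by
      have h3 : ((a i : ℂ) - b j) * (Uᴴ * X * W) i j = 0 := by linear_combination hij
      refine (mul_eq_zero.1 h3).resolve_left ?_
      exact sub_ne_zero.2 (by exact_mod_cast hab)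
    rw [this]; simp

/-- The spectral distribution of a positive semidefinite weight `S` with respect to `A`. -/
theorem exists_spectral_weights {A S : Matrix n n ℂ} (hA : A.IsHermitian) (hS : S.PosSemidef) :
    ∃ p a : n → ℝ, (∀ i, 0 ≤ p i) ∧ (∀ i, a i ∈ spectrum ℝ A) ∧
      ∀ f : ℝ → ℝ, (S * cfc f A).trace = ((∑ i, p i * f (a i) : ℝ) : ℂ) := by
  obtain ⟨U, a, -, -, ha, hf⟩ := exists_diagonalization hA
  have hps := hS.conjTranspose_mul_mul_same U
  refine ⟨fun i => ((Uᴴ * S * U) i i).re, a, fun i => ?_, ha, fun f => ?_⟩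
  · exact (Complex.le_def.1 (hps.diag_nonneg (i := i))).1
  · rw [hf, ← Matrix.mul_assoc, trace_mul_comm]
    simp only [← Matrix.mul_assoc]
    simp only [trace, diag_apply, mul_diagonal]
    push_cast
    refine Finset.sum_congr rfl fun i _ => ?_
    congr 1
    have him := (Complex.le_def.1 (hps.diag_nonneg (i := i))).2
    apply Complex.ext
    · simp
    · simpa using him.symm

/-- The projection onto the support of a positive semidefinite matrix. -/
noncomputable def suppProj (A : Matrix n n ℂ) : Matrix n n ℂ :=
  cfc (fun x : ℝ => if x = 0 then 0 else 1) A

theorem suppProj_isHermitian (A : Matrix n n ℂ) : (suppProj A).IsHermitian := cfc_isHermitian _ _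

theorem psdPow_isHermitian (A : Matrix n n ℂ) (p : ℝ) : (psdPow A p).IsHermitian :=
  cfc_isHermitian _ _

variable {A : Matrix n n ℂ}

theorem suppProj_mul_psdPow (hA : A.PosSemidef) {p : ℝ} (hp : p ≠ 0) :
    suppProj A * psdPow A p = psdPow A p :=
  cfc_mul_eq hA fun x _ => by split_ifs with h <;> simp [h, hp]

theorem psdPow_mul_suppProj (hA : A.PosSemidef) {p : ℝ} (hp : p ≠ 0) :
    psdPow A p * suppProj A = psdPow A p :=
  cfc_mul_eq hA fun x _ => by split_ifs with h <;> simp [h, hp]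

theorem psdPow_one (hA : A.PosSemidef) : psdPow A 1 = A := by
  simp only [psdPow, Real.rpow_one]
  exact cfc_id_eq hA.1

theorem mul_suppProj (hA : A.PosSemidef) : A * suppProj A = A := by
  simpa only [psdPow_one hA] using psdPow_mul_suppProj hA one_ne_zero

theorem psdPow_mul_psdPow (hA : A.PosSemidef) {p q r : ℝ} (hp : p ≠ 0) (hr : r ≠ 0)
    (h : p + q = r) : psdPow A p * psdPow A q = psdPow A r := by
  refine cfc_mul_eq hA fun x hx => ?_
  rcases hx.eq_or_lt with rfl | hx
  · simp [Real.zero_rpow hp, Real.zero_rpow hr]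
  · rw [← h, Real.rpow_add hx]

theorem psdPow_mul_psdPow_eq_suppProj (hA : A.PosSemidef) {p q : ℝ} (hp : p ≠ 0)
    (h : p + q = 0) : psdPow A p * psdPow A q = suppProj A := by
  refine cfc_mul_eq hA fun x hx => ?_
  rcases hx.eq_or_lt with rfl | hx
  · simp [Real.zero_rpow hp]
  · rw [← Real.rpow_add hx, h, Real.rpow_zero, if_neg hx.ne']

theorem psdPow_half_mul_self (hA : A.PosSemidef) : psdPow A (1 / 2) * psdPow A (1 / 2) = A := by
  rw [psdPow_mul_psdPow hA (by norm_num) one_ne_zero (by norm_num), psdPow_one hA]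

theorem psdPow_neg_half_mul (hA : A.PosSemidef) :
    psdPow A (-1 / 2) * A = psdPow A (1 / 2) := by
  nth_rewrite 2 [← psdPow_one hA]
  exact psdPow_mul_psdPow hA (by norm_num) (by norm_num) (by norm_num)

theorem suppProj_of_posDef (hA : A.PosDef) : suppProj A = 1 := by
  rw [suppProj, ← cfc_const_one ℝ A hA.1]
  exact cfc_congr fun x hx => if_neg (spectrum_pos hA hx).ne'

theorem resolvent_mul (hA : A.PosSemidef) {s : ℝ} (hs : 0 < s) :
    cfc (fun x : ℝ => (x + s)⁻¹) A * (A + (s : ℂ) • 1) = 1 ∧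
      (A + (s : ℂ) • 1) * cfc (fun x : ℝ => (x + s)⁻¹) A = 1 := by
  have h1 : A + (s : ℂ) • (1 : Matrix n n ℂ) = cfc (fun x : ℝ => x + s) A := by
    have h := cfc_add A (fun x : ℝ => x) (fun _ => s) (continuousOn_spectrum A _)
      (continuousOn_spectrum A _)
    rw [h, cfc_id_eq hA.1, cfc_const s A hA.1.isSelfAdjoint, Algebra.algebraMap_eq_smul_one]
    rfl
  have h2 : cfc (fun x : ℝ => (x + s)⁻¹) A * cfc (fun x : ℝ => x + s) A = 1 := by
    rw [← cfc_const_one ℝ A hA.1]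
    exact cfc_mul_eq hA fun x hx => inv_mul_cancel₀ (by positivity)
  rw [h1]
  exact ⟨h2, by rw [cfc_commute, h2]⟩

end FunctionalCalculus

/-! ### The partial trace and its bimodule property. -/

section PartialTrace

variable {k v : Type*}

theorem kronecker_one_mul_kronecker_one [Fintype k] [Fintype v] [DecidableEq v] (X Y : Matrix k k ℂ) :
    (X ⊗ₖ (1 : Matrix v v ℂ)) * (Y ⊗ₖ (1 : Matrix v v ℂ)) = (X * Y) ⊗ₖ (1 : Matrix v v ℂ) := by
  rw [← mul_kronecker_mul, Matrix.mul_one]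

theorem conjTranspose_kronecker_one [DecidableEq v] (X : Matrix k k ℂ) :
    (X ⊗ₖ (1 : Matrix v v ℂ))ᴴ = Xᴴ ⊗ₖ (1 : Matrix v v ℂ) := by
  rw [conjTranspose_kronecker, conjTranspose_one]

theorem sub_kronecker_one [DecidableEq v] (X Y : Matrix k k ℂ) :
    (X - Y) ⊗ₖ (1 : Matrix v v ℂ) = X ⊗ₖ (1 : Matrix v v ℂ) - Y ⊗ₖ (1 : Matrix v v ℂ) := by
  ext i j
  simp [sub_mul]

theorem partialTrace_add [Fintype v] (A B : Matrix (k × v) (k × v) ℂ) :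
    partialTrace (A + B) = partialTrace A + partialTrace B := by
  ext i j
  simp [partialTrace, Finset.sum_add_distrib]

theorem partialTrace_sub [Fintype v] (A B : Matrix (k × v) (k × v) ℂ) :
    partialTrace (A - B) = partialTrace A - partialTrace B := by
  ext i j
  simp [partialTrace, Finset.sum_sub_distrib]

theorem partialTrace_smul [Fintype v] (c : ℂ) (A : Matrix (k × v) (k × v) ℂ) :
    partialTrace (c • A) = c • partialTrace A := by
  ext i j
  simp [partialTrace, Finset.mul_sum]

theorem partialTrace_posSemidef [Fintype v] {A : Matrix (k × v) (k × v) ℂ} (hA : A.PosSemidef) :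
    (partialTrace A).PosSemidef := by
  have h : partialTrace A = ∑ a : v, A.submatrix (fun i => (i, a)) (fun i => (i, a)) := by
    ext i j
    simp [partialTrace, Matrix.sum_apply]
  rw [h]
  exact posSemidef_sum _ fun a _ => hA.submatrix _

variable [Fintype k] [Fintype v]

theorem partialTrace_mul_kronecker [DecidableEq v] (A : Matrix (k × v) (k × v) ℂ) (X : Matrix k k ℂ) :
    partialTrace (A * (X ⊗ₖ (1 : Matrix v v ℂ))) = partialTrace A * X := by
  ext i j
  simp only [partialTrace, of_apply, mul_apply, kroneckerMap_apply, one_apply,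
    Fintype.sum_prod_type, mul_ite, mul_one, mul_zero, Finset.sum_ite_eq', Finset.mem_univ,
    if_true, Finset.sum_mul]
  exact Finset.sum_comm

theorem partialTrace_kronecker_mul [DecidableEq v] (A : Matrix (k × v) (k × v) ℂ) (X : Matrix k k ℂ) :
    partialTrace ((X ⊗ₖ (1 : Matrix v v ℂ)) * A) = X * partialTrace A := by
  ext i j
  simp only [partialTrace, of_apply, mul_apply, kroneckerMap_apply, one_apply,
    Fintype.sum_prod_type, mul_ite, mul_one, mul_zero, ite_mul, zero_mul, Finset.sum_ite_eq,
    Finset.mem_univ, if_true, Finset.mul_sum]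
  exact Finset.sum_comm

theorem trace_partialTrace (A : Matrix (k × v) (k × v) ℂ) :
    (partialTrace A).trace = A.trace := by
  simp [partialTrace, trace, Fintype.sum_prod_type]

end PartialTrace

/-! ### The BS entropy as a trace against log Γ. -/

section BSFormula

variable {n : Type*} [Fintype n] [DecidableEq n] {σ ρ : Matrix n n ℂ}

theorem gam_posSemidef (hρ : ρ.PosSemidef) : (gam σ ρ).PosSemidef := by
  have h := hρ.mul_mul_conjTranspose_same (psdPow σ (-1 / 2))
  rwa [(psdPow_isHermitian σ (-1 / 2)).eq] at h

theorem suppProj_mul_gam (hσ : σ.PosSemidef) : suppProj σ * gam σ ρ = gam σ ρ := by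
  rw [gam, ← Matrix.mul_assoc, ← Matrix.mul_assoc, suppProj_mul_psdPow hσ (by norm_num)]

theorem gam_mul_suppProj (hσ : σ.PosSemidef) : gam σ ρ * suppProj σ = gam σ ρ := by
  rw [gam, Matrix.mul_assoc, psdPow_mul_suppProj hσ (by norm_num)]

/-- For matrices of equal support, `σ^{1/2} ρ^{-1} σ^{1/2}` is the Moore-Penrose inverse of
`σ^{-1/2} ρ σ^{-1/2}`, whose support is that of `σ`. -/
theorem cfc_inv_gam (hσ : σ.PosSemidef) (hρ : ρ.PosSemidef) (hσρ : suppProj σ * ρ = ρ)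
    (hρσ : suppProj ρ * σ = σ) :
    suppProj (gam σ ρ) = suppProj σ ∧
      cfc (fun x : ℝ => x⁻¹) (gam σ ρ) = psdPow σ (1 / 2) * psdPow ρ (-1) * psdPow σ (1 / 2) := by
  have hG := gam_posSemidef (σ := σ) hρ
  have hPG := suppProj_mul_gam (ρ := ρ) hσ
  set G := gam σ ρ with hGdef
  set H := psdPow σ (1 / 2) * psdPow ρ (-1) * psdPow σ (1 / 2) with hHdef
  have hρσ' : suppProj ρ * psdPow σ (1 / 2) = psdPow σ (1 / 2) := by
    have h : σ * psdPow σ (-1 / 2) = psdPow σ (1 / 2) := by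
      nth_rewrite 1 [← psdPow_one hσ]
      exact psdPow_mul_psdPow hσ one_ne_zero (by norm_num) (by norm_num)
    rw [← h, ← Matrix.mul_assoc, hρσ]
  have hρρ : ρ * psdPow ρ (-1) = suppProj ρ := by
    nth_rewrite 1 [← psdPow_one hρ]
    exact psdPow_mul_psdPow_eq_suppProj hρ one_ne_zero (by norm_num)
  have hss : psdPow σ (-1 / 2) * psdPow σ (1 / 2) = suppProj σ :=
    psdPow_mul_psdPow_eq_suppProj hσ (by norm_num) (by norm_num)
  have hρs : ρ * suppProj σ = ρ := by
    have h := congrArg conjTranspose hσρ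
    rwa [conjTranspose_mul, hρ.1.eq, (suppProj_isHermitian σ).eq] at h
  have hGH : G * H = suppProj σ := by
    calc G * H = psdPow σ (-1 / 2) * (ρ * (psdPow σ (-1 / 2) * psdPow σ (1 / 2))) *
          psdPow ρ (-1) * psdPow σ (1 / 2) := by simp only [hGdef, hHdef, gam, Matrix.mul_assoc]
      _ = psdPow σ (-1 / 2) * ((ρ * psdPow ρ (-1)) * psdPow σ (1 / 2)) := by
          rw [hss, hρs]; simp only [Matrix.mul_assoc]
      _ = suppProj σ := by rw [hρρ, hρσ', hss]
  have hHh : Hᴴ = H := by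
    simp only [hHdef, conjTranspose_mul, (psdPow_isHermitian _ _).eq, Matrix.mul_assoc]
  have hHG : H * G = suppProj σ := by
    have h := congrArg conjTranspose hGH
    rwa [conjTranspose_mul, hHh, hG.1.eq, (suppProj_isHermitian σ).eq] at h
  have hPH : suppProj σ * H = H := by
    rw [hHdef, ← Matrix.mul_assoc, ← Matrix.mul_assoc, suppProj_mul_psdPow hσ (by norm_num)]
  have hGI : G * cfc (fun x : ℝ => x⁻¹) G = suppProj G := by
    nth_rewrite 1 [← cfc_id_eq hG.1]
    exact cfc_mul_eq hG fun x _ => by split_ifs with h <;> simp [h]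
  have hIG : cfc (fun x : ℝ => x⁻¹) G * G = suppProj G := by
    nth_rewrite 2 [← cfc_id_eq hG.1]
    exact cfc_mul_eq hG fun x _ => by split_ifs with h <;> simp [h]
  have hIS : cfc (fun x : ℝ => x⁻¹) G * suppProj G = cfc (fun x : ℝ => x⁻¹) G :=
    cfc_mul_eq hG fun x _ => by split_ifs with h <;> simp [h]
  -- Both projections equal their product: that of σ fixes `G`, and `H * G` is absorbed on the right
  -- by that of `G`.
  have hS : suppProj G = suppProj σ := by
    calc suppProj G = suppProj σ * suppProj G := by rw [← hGI, ← Matrix.mul_assoc, hPG]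
      _ = suppProj σ := by rw [← hHG, Matrix.mul_assoc, mul_suppProj hG]
  refine ⟨hS, ?_⟩
  rw [← hIS, hS, ← hGH, ← Matrix.mul_assoc, hIG, hS, hPH]

/-- By `cfc_inv_gam` the argument of the logarithm is the inverse of `gam σ ρ` on its support. Off
the support nothing is lost, since `Real.log x⁻¹ = -Real.log x` also at 0. -/
theorem bsEntropy_eq_neg_trace (hσ : σ.PosSemidef) (hρ : ρ.PosSemidef)
    (hσρ : suppProj σ * ρ = ρ) (hρσ : suppProj ρ * σ = σ) :
    bsEntropy σ ρ = ((-(σ * cfc Real.log (gam σ ρ)).trace.re : ℝ) : EReal) := by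
  have hker : ∀ x : n → ℂ, ρ *ᵥ x = 0 → σ *ᵥ x = 0 := by
    intro x hx
    have h1 : psdPow ρ (-1) * ρ = suppProj ρ := by
      nth_rewrite 2 [← psdPow_one hρ]
      exact psdPow_mul_psdPow_eq_suppProj hρ (by norm_num) (by norm_num)
    have h2 : σ * (psdPow ρ (-1) * ρ) = σ := by
      have h := congrArg conjTranspose hρσ
      rwa [conjTranspose_mul, hσ.1.eq, (suppProj_isHermitian ρ).eq, ← h1] at h
    rw [← h2, ← Matrix.mul_assoc, ← mulVec_mulVec, hx, mulVec_zero]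
  have hlog : cfc Real.log (psdPow σ (1 / 2) * psdPow ρ (-1) * psdPow σ (1 / 2)) =
      -cfc Real.log (gam σ ρ) := by
    rw [← (cfc_inv_gam hσ hρ hσρ hρσ).2, ← cfc_comp' Real.log (fun x : ℝ => x⁻¹) (gam σ ρ)
      (((gam σ ρ).finite_real_spectrum.image _).continuousOn _) (continuousOn_spectrum _ _)
      (gam_posSemidef hρ).1.isSelfAdjoint, ← cfc_neg]
    simp only [Real.log_inv]
  rw [bsEntropy, if_pos hker, hlog, Matrix.mul_neg, trace_neg, Complex.neg_re]

/-- Spectral weights of `σ` with respect to `σ^{-1/2} ρ σ^{-1/2}`. -/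
theorem exists_gam_weights (hσ : σ.PosSemidef) (hρ : ρ.PosSemidef)
    (hσρ : suppProj σ * ρ = ρ) (hρσ : suppProj ρ * σ = σ) :
    ∃ p a : n → ℝ, (∀ i, 0 ≤ a i) ∧ (∀ i, a i = 0 → p i = 0) ∧
      ∀ f : ℝ → ℝ, (σ * cfc f (gam σ ρ)).trace = ((∑ i, p i * f (a i) : ℝ) : ℂ) := by
  have hG := gam_posSemidef (σ := σ) hρ
  obtain ⟨p, a, hp, ha, hf⟩ := exists_spectral_weights hG.1 hσ
  refine ⟨p, a, fun i => spectrum_nonneg hG (ha i), fun i hi => ?_, hf⟩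
  -- The test functions 1 and 1_{x ≠ 0} give the same trace, because the support of `gam σ ρ` is
  -- that of σ. The nonnegative weights at the eigenvalue 0 therefore sum to 0.
  have h1 := hf (fun x => if x = 0 then 0 else 1)
  have h2 := hf (fun _ => 1)
  change (σ * suppProj (gam σ ρ)).trace = _ at h1
  rw [(cfc_inv_gam hσ hρ hσρ hρσ).1, mul_suppProj hσ] at h1
  rw [cfc_const_one ℝ _ hG.1.isSelfAdjoint, Matrix.mul_one, h1] at h2
  have h3 : ∑ i, p i * (1 - if a i = 0 then (0 : ℝ) else 1) = 0 := by
    simp only [mul_sub, Finset.sum_sub_distrib]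
    exact sub_eq_zero.2 (by exact_mod_cast h2.symm)
  have h4 := (Finset.sum_eq_zero_iff_of_nonneg fun i _ => mul_nonneg (hp i)
    (by split_ifs <;> norm_num)).1 h3 i (Finset.mem_univ i)
  simpa [hi] using h4

end BSFormula

/-! ### The dilation operator D and the compression X ↦ tr_v[D* X D]. -/

section Dilation

variable {m k v : Type*} [Fintype m] [DecidableEq m] [Fintype k] [DecidableEq k]
    [Fintype v] [DecidableEq v]

theorem trace_mul_nonneg {A B : Matrix m m ℂ} (hA : A.PosSemidef) (hB : B.PosSemidef) :
    0 ≤ (A * B).trace := by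
  have h := (hB.mul_mul_conjTranspose_same (psdPow A (1 / 2))).trace_nonneg
  rwa [(psdPow_isHermitian A _).eq, trace_mul_comm, ← Matrix.mul_assoc,
    psdPow_half_mul_self hA] at h

theorem eq_zero_of_trace_eq_zero {l : Type*} [Fintype l] {X : Matrix m m ℂ} (hX : X.PosDef)
    {Z : Matrix m l ℂ} (h : (Zᴴ * X * Z).trace = 0) : Z = 0 := by
  have h1 : Zᴴ * X * Z = (psdPow X (1 / 2) * Z)ᴴ * (psdPow X (1 / 2) * Z) := by
    rw [conjTranspose_mul, (psdPow_isHermitian X _).eq]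
    nth_rewrite 1 [← psdPow_half_mul_self hX.posSemidef]
    simp only [Matrix.mul_assoc]
  rw [h1, trace_conjTranspose_mul_self_eq_zero_iff] at h
  have h2 : X * Z = 0 := by
    rw [← psdPow_half_mul_self hX.posSemidef, Matrix.mul_assoc, h, Matrix.mul_zero]
  have h3 := congrArg (fun W => X⁻¹ * W) h2
  simpa [← Matrix.mul_assoc, nonsing_inv_mul X ((isUnit_iff_isUnit_det X).1 hX.isUnit)] using h3

/-- The form Z* X Z with Z = V*(B ⊗ 1) has trace tr[B* τ B], where τ = tr_v[V X V*]. With B the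
projection onto the kernel of τ, this places the range of `V` inside supp(τ) ⊗ ℂ^v. -/
theorem conjTranspose_mul_kronecker_eq_zero {X : Matrix m m ℂ} (hX : X.PosDef)
    (V : Matrix (k × v) m ℂ) {B : Matrix k k ℂ} (h : partialTrace (V * X * Vᴴ) * B = 0) :
    Vᴴ * (B ⊗ₖ (1 : Matrix v v ℂ)) = 0 := by
  refine eq_zero_of_trace_eq_zero hX ?_
  have h1 : (Vᴴ * (B ⊗ₖ (1 : Matrix v v ℂ)))ᴴ * X * (Vᴴ * (B ⊗ₖ (1 : Matrix v v ℂ))) =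
      (Bᴴ ⊗ₖ (1 : Matrix v v ℂ)) * (V * X * Vᴴ * (B ⊗ₖ (1 : Matrix v v ℂ))) := by
    rw [conjTranspose_mul, conjTranspose_conjTranspose, conjTranspose_kronecker_one]
    simp only [Matrix.mul_assoc]
  rw [h1, ← trace_partialTrace, partialTrace_kronecker_mul, partialTrace_mul_kronecker, h]
  simp

theorem conjTranspose_mul_suppProj {X : Matrix m m ℂ} (hX : X.PosDef)
    (V : Matrix (k × v) m ℂ) :
    Vᴴ * (suppProj (partialTrace (V * X * Vᴴ)) ⊗ₖ (1 : Matrix v v ℂ)) = Vᴴ := by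
  have hτ := partialTrace_posSemidef (hX.posSemidef.mul_mul_conjTranspose_same V)
  have h := conjTranspose_mul_kronecker_eq_zero hX V
    (B := 1 - suppProj (partialTrace (V * X * Vᴴ)))
    (by rw [Matrix.mul_sub, Matrix.mul_one, mul_suppProj hτ, sub_self])
  rw [sub_kronecker_one, one_kronecker_one, Matrix.mul_sub, Matrix.mul_one, sub_eq_zero] at h
  exact h.symm

/-- Used with (σ, ρ) and with (ρ, σ): the two output states have the same support even if both are
singular. -/
theorem suppProj_mul_partialTrace {X : Matrix m m ℂ} (hX : X.PosDef) (Y : Matrix m m ℂ)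
    (V : Matrix (k × v) m ℂ) :
    suppProj (partialTrace (V * X * Vᴴ)) * partialTrace (V * Y * Vᴴ) =
      partialTrace (V * Y * Vᴴ) := by
  rw [← partialTrace_kronecker_mul]
  have h := congrArg conjTranspose (conjTranspose_mul_suppProj hX V)
  rw [conjTranspose_mul, conjTranspose_kronecker_one, (suppProj_isHermitian _).eq,
    conjTranspose_conjTranspose] at h
  rw [← Matrix.mul_assoc, ← Matrix.mul_assoc, h]

/-- The operator `σ^{1/2} V* (τ^{-1/2} ⊗ 1)`, `τ = tr_v[V σ V*]`. -/
noncomputable def dilationOp (σ : Matrix m m ℂ) (V : Matrix (k × v) m ℂ) : Matrix m (k × v) ℂ :=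
  psdPow σ (1 / 2) * Vᴴ *
    (psdPow (partialTrace (V * σ * Vᴴ)) (-1 / 2) ⊗ₖ (1 : Matrix v v ℂ))

theorem dilationOp_mul_kronecker_half {σ : Matrix m m ℂ} (hσ : σ.PosDef)
    (V : Matrix (k × v) m ℂ) :
    dilationOp σ V * (psdPow (partialTrace (V * σ * Vᴴ)) (1 / 2) ⊗ₖ (1 : Matrix v v ℂ)) =
      psdPow σ (1 / 2) * Vᴴ := by
  have hτ := partialTrace_posSemidef (hσ.posSemidef.mul_mul_conjTranspose_same V)
  rw [dilationOp, Matrix.mul_assoc, kronecker_one_mul_kronecker_one,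
    psdPow_mul_psdPow_eq_suppProj hτ (by norm_num) (by norm_num), Matrix.mul_assoc,
    conjTranspose_mul_suppProj hσ]

theorem dilationOp_mul_suppProj {σ : Matrix m m ℂ} (hσ : σ.PosDef) (V : Matrix (k × v) m ℂ) :
    dilationOp σ V * (suppProj (partialTrace (V * σ * Vᴴ)) ⊗ₖ (1 : Matrix v v ℂ)) =
      dilationOp σ V := by
  have hτ := partialTrace_posSemidef (hσ.posSemidef.mul_mul_conjTranspose_same V)
  rw [dilationOp, Matrix.mul_assoc, kronecker_one_mul_kronecker_one,
    psdPow_mul_suppProj hτ (by norm_num)]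

/-- The compression by D is the channel sandwiched between σ^{1/2} and τ^{-1/2}; its values at 1 and
at `gam σ ρ` follow from this form. -/
theorem partialTrace_dilationOp (σ : Matrix m m ℂ) (V : Matrix (k × v) m ℂ) (X : Matrix m m ℂ) :
    partialTrace ((dilationOp σ V)ᴴ * X * dilationOp σ V) =
      psdPow (partialTrace (V * σ * Vᴴ)) (-1 / 2) *
        partialTrace (V * (psdPow σ (1 / 2) * X * psdPow σ (1 / 2)) * Vᴴ) *
          psdPow (partialTrace (V * σ * Vᴴ)) (-1 / 2) := by
  rw [← partialTrace_kronecker_mul, ← partialTrace_mul_kronecker]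
  congr 1
  simp only [dilationOp, conjTranspose_mul, conjTranspose_conjTranspose,
    conjTranspose_kronecker_one, (psdPow_isHermitian _ _).eq, Matrix.mul_assoc]

theorem partialTrace_dilationOp_one {σ : Matrix m m ℂ} (hσ : σ.PosDef)
    (V : Matrix (k × v) m ℂ) :
    partialTrace ((dilationOp σ V)ᴴ * dilationOp σ V) =
      suppProj (partialTrace (V * σ * Vᴴ)) := by
  have hτ := partialTrace_posSemidef (hσ.posSemidef.mul_mul_conjTranspose_same V)
  have h := partialTrace_dilationOp σ V 1
  rw [Matrix.mul_one, Matrix.mul_one, psdPow_half_mul_self hσ.posSemidef, psdPow_neg_half_mul hτ,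
    psdPow_mul_psdPow_eq_suppProj hτ (by norm_num) (by norm_num)] at h
  exact h

theorem half_mul_gam_mul_half {σ : Matrix m m ℂ} (hσ : σ.PosDef) (ρ : Matrix m m ℂ) :
    psdPow σ (1 / 2) * gam σ ρ * psdPow σ (1 / 2) = ρ := by
  have h1 : psdPow σ (1 / 2) * psdPow σ (-1 / 2) = 1 := by
    rw [psdPow_mul_psdPow_eq_suppProj hσ.posSemidef (by norm_num) (by norm_num),
      suppProj_of_posDef hσ]
  have h2 : psdPow σ (-1 / 2) * psdPow σ (1 / 2) = 1 := by
    rw [psdPow_mul_psdPow_eq_suppProj hσ.posSemidef (by norm_num) (by norm_num),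
      suppProj_of_posDef hσ]
  rw [gam, ← Matrix.mul_assoc, ← Matrix.mul_assoc, h1, Matrix.one_mul, Matrix.mul_assoc, h2,
    Matrix.mul_one]

/-- Expresses the second moment of Γ in the form produced by pairing σ^{-1}ρ with ρ. -/
theorem trace_mul_gam_mul_gam {σ ρ : Matrix m m ℂ} (hσ : σ.PosSemidef)
    (hσρ : suppProj σ * ρ = ρ) :
    (σ * (gam σ ρ * gam σ ρ)).trace = (ρ * psdPow σ (-1) * ρ).trace := by
  have h1 : psdPow σ (-1 / 2) * psdPow σ (-1 / 2) = psdPow σ (-1) :=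
    psdPow_mul_psdPow hσ (by norm_num) (by norm_num) (by norm_num)
  have h2 : psdPow σ (-1 / 2) * (σ * psdPow σ (-1 / 2)) = suppProj σ := by
    rw [← Matrix.mul_assoc, psdPow_neg_half_mul hσ,
      psdPow_mul_psdPow_eq_suppProj hσ (by norm_num) (by norm_num)]
  calc (σ * (gam σ ρ * gam σ ρ)).trace
      = (σ * psdPow σ (-1 / 2) * (ρ * (psdPow σ (-1 / 2) * psdPow σ (-1 / 2)) * ρ) *
          psdPow σ (-1 / 2)).trace := by simp only [gam, Matrix.mul_assoc]
    _ = (suppProj σ * (ρ * psdPow σ (-1) * ρ)).trace := by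
        rw [h1, trace_mul_comm, ← Matrix.mul_assoc, h2]
    _ = _ := by rw [← Matrix.mul_assoc, ← Matrix.mul_assoc, hσρ]

theorem partialTrace_dilationOp_gam {σ : Matrix m m ℂ} (hσ : σ.PosDef) (ρ : Matrix m m ℂ)
    (V : Matrix (k × v) m ℂ) :
    partialTrace ((dilationOp σ V)ᴴ * gam σ ρ * dilationOp σ V) =
      gam (partialTrace (V * σ * Vᴴ)) (partialTrace (V * ρ * Vᴴ)) := by
  rw [partialTrace_dilationOp, half_mul_gam_mul_half hσ]
  rfl

theorem trace_mul_partialTrace_dilationOp {σ : Matrix m m ℂ} (hσ : σ.PosDef)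
    {V : Matrix (k × v) m ℂ} (hV : Vᴴ * V = 1) (X : Matrix m m ℂ) :
    (partialTrace (V * σ * Vᴴ) * partialTrace ((dilationOp σ V)ᴴ * X * dilationOp σ V)).trace =
      (σ * X).trace := by
  have hτ := partialTrace_posSemidef (hσ.posSemidef.mul_mul_conjTranspose_same V)
  set τ := partialTrace (V * σ * Vᴴ) with hτdef
  have h1 : (psdPow τ (1 / 2) ⊗ₖ (1 : Matrix v v ℂ)) * ((dilationOp σ V)ᴴ * X * dilationOp σ V *
      (psdPow τ (1 / 2) ⊗ₖ (1 : Matrix v v ℂ))) =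
      V * (psdPow σ (1 / 2) * X * psdPow σ (1 / 2) * Vᴴ) := by
    have h := dilationOp_mul_kronecker_half hσ V
    rw [← hτdef] at h
    have h' := congrArg conjTranspose h
    simp only [conjTranspose_mul, conjTranspose_conjTranspose, conjTranspose_kronecker_one,
      (psdPow_isHermitian _ _).eq] at h'
    rw [Matrix.mul_assoc _ (dilationOp σ V), h, Matrix.mul_assoc _ X, ← Matrix.mul_assoc, h']
    simp only [Matrix.mul_assoc]
  nth_rewrite 1 [← psdPow_half_mul_self hτ]
  rw [Matrix.mul_assoc, trace_mul_comm, Matrix.mul_assoc, ← partialTrace_mul_kronecker,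
    ← partialTrace_kronecker_mul, trace_partialTrace, h1, trace_mul_comm, Matrix.mul_assoc, hV,
    Matrix.mul_one, trace_mul_comm, ← Matrix.mul_assoc, psdPow_half_mul_self hσ.posSemidef]

-- Factors S ⊗ 1 leave the partial trace, so only compressions of RXR, RX, XR and X remain. It
-- serves for (R, X) = ((Γ + s)⁻¹, Γ + s) and (Γ, 1), where these simplify.
omit [DecidableEq m] [DecidableEq k] in
theorem partialTrace_defect (D : Matrix m (k × v) ℂ) {R : Matrix m m ℂ} (X : Matrix m m ℂ)
    {S : Matrix k k ℂ} (hR : Rᴴ = R) (hS : Sᴴ = S) :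
    partialTrace ((R * D - D * (S ⊗ₖ (1 : Matrix v v ℂ)))ᴴ * X *
        (R * D - D * (S ⊗ₖ (1 : Matrix v v ℂ)))) =
      partialTrace (Dᴴ * (R * X * R) * D) - partialTrace (Dᴴ * (R * X) * D) * S -
        S * partialTrace (Dᴴ * (X * R) * D) + S * partialTrace (Dᴴ * X * D) * S := by
  rw [Matrix.mul_assoc S, ← partialTrace_mul_kronecker, ← partialTrace_mul_kronecker,
    ← partialTrace_kronecker_mul, ← partialTrace_kronecker_mul, ← partialTrace_sub,
    ← partialTrace_sub, ← partialTrace_add]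
  congr 1
  simp only [conjTranspose_sub, conjTranspose_mul, conjTranspose_kronecker_one, hR, hS,
    Matrix.sub_mul, Matrix.mul_sub, Matrix.mul_assoc]
  abel

/-- A vanishing second-order defect forces the intertwining relation. -/
theorem intertwine_of_trace_eq {σ : Matrix m m ℂ} (hσ : σ.PosDef) {V : Matrix (k × v) m ℂ}
    {R X : Matrix m m ℂ} (hX : X.PosDef) {S : Matrix k k ℂ}
    (hSτ : suppProj (partialTrace (V * σ * Vᴴ)) * S = S * suppProj (partialTrace (V * σ * Vᴴ)))
    (h : (partialTrace (V * σ * Vᴴ) * partialTrace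
      ((R * dilationOp σ V - dilationOp σ V * (S ⊗ₖ (1 : Matrix v v ℂ)))ᴴ * X *
        (R * dilationOp σ V - dilationOp σ V * (S ⊗ₖ (1 : Matrix v v ℂ))))).trace = 0) :
    R * dilationOp σ V = dilationOp σ V * (S ⊗ₖ (1 : Matrix v v ℂ)) := by
  have hτ := partialTrace_posSemidef (hσ.posSemidef.mul_mul_conjTranspose_same V)
  have hDP := dilationOp_mul_suppProj hσ V
  set D := dilationOp σ V
  set τ := partialTrace (V * σ * Vᴴ)
  -- Splitting τ as τ^{1/2} τ^{1/2} and cycling the trace gives a definite quadratic form. Then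
  -- τ^{-1/2} restores the operator up to the support projection, which D absorbs.
  have h1 : (R * D - D * (S ⊗ₖ (1 : Matrix v v ℂ))) * (psdPow τ (1 / 2) ⊗ₖ (1 : Matrix v v ℂ))
      = 0 := by
    refine eq_zero_of_trace_eq_zero hX ?_
    rw [← psdPow_half_mul_self hτ, Matrix.mul_assoc, trace_mul_comm, Matrix.mul_assoc,
      ← partialTrace_mul_kronecker, ← partialTrace_kronecker_mul, trace_partialTrace] at h
    rw [← h, conjTranspose_mul, conjTranspose_kronecker_one, (psdPow_isHermitian _ _).eq]
    simp only [Matrix.mul_assoc]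
  have h2 : (R * D - D * (S ⊗ₖ (1 : Matrix v v ℂ))) * (suppProj τ ⊗ₖ (1 : Matrix v v ℂ)) = 0 := by
    rw [← psdPow_mul_psdPow_eq_suppProj hτ (p := 1 / 2) (q := -1 / 2) (by norm_num) (by norm_num),
      ← kronecker_one_mul_kronecker_one, ← Matrix.mul_assoc, h1, Matrix.zero_mul]
  rw [Matrix.sub_mul, Matrix.mul_assoc, hDP, Matrix.mul_assoc, kronecker_one_mul_kronecker_one,
    ← hSτ, ← kronecker_one_mul_kronecker_one, ← Matrix.mul_assoc, hDP, sub_eq_zero] at h2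
  exact h2

end Dilation

/-! ### Each condition compared with the intertwining relation. -/

section Equality

variable {m k v : Type*} [Fintype m] [DecidableEq m] [Fintype k] [DecidableEq k]
    [Fintype v] [DecidableEq v]

/-- The intertwining relation between `σ^{-1/2} ρ σ^{-1/2}` and its counterpart for the partial
traces of `V σ V*` and `V ρ V*`. -/
def Intertwines (σ ρ : Matrix m m ℂ) (V : Matrix (k × v) m ℂ) : Prop :=
  gam σ ρ * dilationOp σ V = dilationOp σ V *
    (gam (partialTrace (V * σ * Vᴴ)) (partialTrace (V * ρ * Vᴴ)) ⊗ₖ (1 : Matrix v v ℂ))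

variable {σ ρ : Matrix m m ℂ} {V : Matrix (k × v) m ℂ}

/-- B ⊗ 1 is block diagonal, so the relation splits into one for each basis vector of ℂ^v, and only
the functional calculus of `B` itself is needed. -/
theorem cfc_mul_of_intertwine_kronecker {A : Matrix m m ℂ} {B : Matrix k k ℂ}
    (hA : A.IsHermitian) (hB : B.IsHermitian) {D : Matrix m (k × v) ℂ}
    (h : A * D = D * (B ⊗ₖ (1 : Matrix v v ℂ))) (f : ℝ → ℝ) :
    cfc f A * D = D * (cfc f B ⊗ₖ (1 : Matrix v v ℂ)) := by
  have hsl : ∀ (S : Matrix k k ℂ) (c : v),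
      (D * (S ⊗ₖ (1 : Matrix v v ℂ))).submatrix id (fun i => (i, c)) =
        D.submatrix id (fun i => (i, c)) * S := by
    intro S c
    ext i j
    simp [mul_apply, Fintype.sum_prod_type, one_apply]
  ext i ⟨j, c⟩
  have h1 : A * D.submatrix id (fun i => (i, c)) = D.submatrix id (fun i => (i, c)) * B := by
    rw [← hsl, ← h]
    rfl
  have h2 := cfc_mul_of_intertwine hA hB h1 f
  rw [← hsl] at h2
  exact congrFun (congrFun h2 i) j

theorem bsEntropy_dilation_eq_neg_trace (hσ : σ.PosDef) (hρ : ρ.PosDef)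
    (V : Matrix (k × v) m ℂ) :
    bsEntropy (partialTrace (V * σ * Vᴴ)) (partialTrace (V * ρ * Vᴴ)) =
      ((-(partialTrace (V * σ * Vᴴ) * cfc Real.log (gam (partialTrace (V * σ * Vᴴ))
        (partialTrace (V * ρ * Vᴴ)))).trace.re : ℝ) : EReal) :=
  bsEntropy_eq_neg_trace
    (partialTrace_posSemidef (hσ.posSemidef.mul_mul_conjTranspose_same V))
    (partialTrace_posSemidef (hρ.posSemidef.mul_mul_conjTranspose_same V))
    (suppProj_mul_partialTrace hσ ρ V) (suppProj_mul_partialTrace hρ σ V)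

theorem bsEntropy_eq_neg_trace_of_posDef (hσ : σ.PosDef) (hρ : ρ.PosDef) :
    bsEntropy σ ρ = ((-(σ * cfc Real.log (gam σ ρ)).trace.re : ℝ) : EReal) :=
  bsEntropy_eq_neg_trace hσ.posSemidef hρ.posSemidef
    (by rw [suppProj_of_posDef hσ, Matrix.one_mul]) (by rw [suppProj_of_posDef hρ, Matrix.one_mul])

theorem cfc_gam_mul_suppProj (hσ : σ.PosSemidef) (hρ : ρ.PosSemidef) (f : ℝ → ℝ) :
    cfc f (gam σ ρ) * suppProj σ = suppProj σ * cfc f (gam σ ρ) := by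
  have hG := gam_posSemidef (σ := σ) hρ
  exact cfc_mul_of_intertwine hG.1 hG.1
    (by rw [suppProj_mul_gam hσ, gam_mul_suppProj hσ]) f

theorem bsEntropy_eq_of_intertwines (hσ : σ.PosDef) (hρ : ρ.PosDef) (hV : Vᴴ * V = 1)
    (h : Intertwines σ ρ V) :
    bsEntropy σ ρ = bsEntropy (partialTrace (V * σ * Vᴴ)) (partialTrace (V * ρ * Vᴴ)) := by
  have hτ := partialTrace_posSemidef (hσ.posSemidef.mul_mul_conjTranspose_same V)
  have hθ := partialTrace_posSemidef (hρ.posSemidef.mul_mul_conjTranspose_same V)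
  rw [bsEntropy_dilation_eq_neg_trace hσ hρ, bsEntropy_eq_neg_trace_of_posDef hσ hρ,
    ← trace_mul_partialTrace_dilationOp hσ hV,
    Matrix.mul_assoc (dilationOp σ V)ᴴ, cfc_mul_of_intertwine_kronecker (gam_posSemidef hρ.posSemidef).1 (gam_posSemidef hθ).1 h,
    ← Matrix.mul_assoc (dilationOp σ V)ᴴ, partialTrace_mul_kronecker,
    partialTrace_dilationOp_one hσ, ← Matrix.mul_assoc, mul_suppProj hτ]

/-- For X = Γ + s one has RXR = R and RX = XR = 1, while X compresses to (G + s)P with P the support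
projection of τ. The last term of the expansion is then PS and cancels one of the two cross terms;
the weight τ absorbs the remaining P. -/
theorem trace_resolvent_defect (hσ : σ.PosDef) (hρ : ρ.PosDef) (hV : Vᴴ * V = 1) {s : ℝ}
    (hs : 0 < s) {R : Matrix m m ℂ} {S : Matrix k k ℂ}
    (hR : R = cfc (fun x : ℝ => (x + s)⁻¹) (gam σ ρ))
    (hS : S = cfc (fun x : ℝ => (x + s)⁻¹)
      (gam (partialTrace (V * σ * Vᴴ)) (partialTrace (V * ρ * Vᴴ)))) :
    (partialTrace (V * σ * Vᴴ) * partialTrace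
      ((R * dilationOp σ V - dilationOp σ V * (S ⊗ₖ (1 : Matrix v v ℂ)))ᴴ *
        (gam σ ρ + (s : ℂ) • 1) *
        (R * dilationOp σ V - dilationOp σ V * (S ⊗ₖ (1 : Matrix v v ℂ))))).trace =
      (σ * R).trace - (partialTrace (V * σ * Vᴴ) * S).trace := by
  have hτ := partialTrace_posSemidef (hσ.posSemidef.mul_mul_conjTranspose_same V)
  have hθ := partialTrace_posSemidef (hρ.posSemidef.mul_mul_conjTranspose_same V)
  obtain ⟨hRX, hXR⟩ := resolvent_mul (gam_posSemidef (σ := σ) hρ.posSemidef) hs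
  obtain ⟨hSX, -⟩ := resolvent_mul
    (gam_posSemidef (σ := partialTrace (V * σ * Vᴴ)) hθ) hs
  have hSP := cfc_gam_mul_suppProj hτ hθ (fun x : ℝ => (x + s)⁻¹)
  rw [← hR] at hRX hXR
  rw [← hS] at hSX hSP
  have hRh : Rᴴ = R := by rw [hR]; exact cfc_isHermitian _ _
  have hSh : Sᴴ = S := by rw [hS]; exact cfc_isHermitian _ _
  have hX : partialTrace ((dilationOp σ V)ᴴ * (gam σ ρ + (s : ℂ) • 1) * dilationOp σ V) =
      (gam (partialTrace (V * σ * Vᴴ)) (partialTrace (V * ρ * Vᴴ)) + (s : ℂ) • 1) *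
        suppProj (partialTrace (V * σ * Vᴴ)) := by
    rw [Matrix.mul_add, Matrix.add_mul, partialTrace_add, partialTrace_dilationOp_gam hσ,
      Matrix.add_mul, gam_mul_suppProj hτ, Matrix.mul_smul, Matrix.smul_mul, Matrix.mul_one,
      partialTrace_smul, partialTrace_dilationOp_one hσ, Matrix.smul_mul, Matrix.one_mul]
  rw [partialTrace_defect _ _ hRh hSh, hX, hRX, hXR, Matrix.one_mul, Matrix.mul_one,
    partialTrace_dilationOp_one hσ, ← Matrix.mul_assoc S, hSX, Matrix.one_mul, hSP, sub_add_cancel,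
    Matrix.mul_sub, trace_sub, trace_mul_partialTrace_dilationOp hσ hV, ← Matrix.mul_assoc,
    mul_suppProj hτ]

theorem intertwines_of_bsEntropy_eq (hσ : σ.PosDef) (hρ : ρ.PosDef) (hV : Vᴴ * V = 1)
    (h : bsEntropy σ ρ = bsEntropy (partialTrace (V * σ * Vᴴ)) (partialTrace (V * ρ * Vᴴ))) :
    Intertwines σ ρ V := by
  have hτ := partialTrace_posSemidef (hσ.posSemidef.mul_mul_conjTranspose_same V)
  have hθ := partialTrace_posSemidef (hρ.posSemidef.mul_mul_conjTranspose_same V)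
  rw [bsEntropy_dilation_eq_neg_trace hσ hρ, bsEntropy_eq_neg_trace_of_posDef hσ hρ,
    EReal.coe_eq_coe_iff, neg_inj] at h
  have hdef := fun (s : ℝ) (hs : 0 < s) => trace_resolvent_defect hσ hρ hV hs rfl rfl
  obtain ⟨p, a, ha, hpa, hp⟩ := exists_gam_weights hσ.posSemidef hρ.posSemidef
    (by rw [suppProj_of_posDef hσ, Matrix.one_mul]) (by rw [suppProj_of_posDef hρ, Matrix.one_mul])
  obtain ⟨q, b, hb, hqb, hq⟩ := exists_gam_weights hτ hθ
    (suppProj_mul_partialTrace hσ ρ V) (suppProj_mul_partialTrace hρ σ V)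
  rw [hp, hq, Complex.ofReal_re, Complex.ofReal_re] at h
  have hXpos : ∀ s : ℝ, 0 < s → (gam σ ρ + (s : ℂ) • (1 : Matrix m m ℂ)).PosDef := fun s hs =>
    PosDef.posSemidef_add (gam_posSemidef hρ.posSemidef)
      (PosDef.one.smul (by exact_mod_cast hs : (0 : ℂ) < s))
  have hsum : ∑ i, p i = ∑ j, q j := by
    have h1 := hp fun _ => 1
    have h2 := hq fun _ => 1
    rw [cfc_const_one ℝ _ (gam_posSemidef hρ.posSemidef).1.isSelfAdjoint, Matrix.mul_one] at h1
    rw [cfc_const_one ℝ _ (gam_posSemidef hθ).1.isSelfAdjoint, Matrix.mul_one,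
      trace_partialTrace, trace_mul_comm, ← Matrix.mul_assoc, hV, Matrix.one_mul, h1] at h2
    simpa using (by exact_mod_cast h2 : ∑ i, p i * 1 = ∑ j, q j * 1)
  -- The difference of the two sides is the resolvent defect, the trace of a product of two positive
  -- semidefinite matrices.
  have hle : ∀ s : ℝ, 0 < s → ∑ j, q j * (b j + s)⁻¹ ≤ ∑ i, p i * (a i + s)⁻¹ := by
    intro s hs
    have h1 := hdef s hs
    rw [hp, hq] at h1
    have h2 := trace_mul_nonneg hτ (partialTrace_posSemidef
      ((hXpos s hs).posSemidef.conjTranspose_mul_mul_same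
        (cfc (fun x : ℝ => (x + s)⁻¹) (gam σ ρ) * dilationOp σ V - dilationOp σ V *
          (cfc (fun x : ℝ => (x + s)⁻¹) (gam (partialTrace (V * σ * Vᴴ))
            (partialTrace (V * ρ * Vᴴ))) ⊗ₖ (1 : Matrix v v ℂ)))))
    rw [h1] at h2
    exact sub_nonneg.1 (by exact_mod_cast h2)
  have heq := sum_inv_eq_of_sum_log_eq ha hb hpa hqb hsum h hle one_pos
  have h0 := hdef 1 one_pos
  rw [hp, hq, heq, sub_self] at h0
  have hRS := intertwine_of_trace_eq hσ (hXpos 1 one_pos) (cfc_gam_mul_suppProj hτ hθ _).symm h0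
  obtain ⟨-, hXR⟩ := resolvent_mul (gam_posSemidef (σ := σ) hρ.posSemidef) one_pos
  obtain ⟨hSX, -⟩ := resolvent_mul
    (gam_posSemidef (σ := partialTrace (V * σ * Vᴴ)) hθ) one_pos
  -- Multiplying by Γ + 1 on the left and (G + 1) ⊗ 1 on the right clears both resolvents; the two
  -- copies of D then cancel.
  have h1 := congrArg (fun Z => (gam σ ρ + ((1 : ℝ) : ℂ) • 1) * Z *
    ((gam (partialTrace (V * σ * Vᴴ)) (partialTrace (V * ρ * Vᴴ)) + ((1 : ℝ) : ℂ) • 1) ⊗ₖ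
      (1 : Matrix v v ℂ))) hRS
  simp only [] at h1
  rw [← Matrix.mul_assoc, hXR, Matrix.one_mul, ← Matrix.mul_assoc,
    Matrix.mul_assoc _ (_ ⊗ₖ _) (_ ⊗ₖ _), kronecker_one_mul_kronecker_one, hSX, one_kronecker_one,
    Matrix.mul_one, Complex.ofReal_one, one_smul, one_smul, Matrix.add_mul, Matrix.one_mul,
    add_kronecker, one_kronecker_one, Matrix.mul_add, Matrix.mul_one] at h1
  exact (add_right_cancel h1).symm

/-- The defect with R = Γ, S = G and X = 1 has weighted trace tr[σΓ²] - tr[τG²]; this is the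
equality case of a Kadison–Schwarz inequality. -/
theorem intertwines_of_trace_eq (hσ : σ.PosDef) (hρ : ρ.PosDef) (hV : Vᴴ * V = 1)
    (h : (ρ * psdPow σ (-1) * ρ).trace = (partialTrace (V * ρ * Vᴴ) *
      psdPow (partialTrace (V * σ * Vᴴ)) (-1) * partialTrace (V * ρ * Vᴴ)).trace) :
    Intertwines σ ρ V := by
  have hτ := partialTrace_posSemidef (hσ.posSemidef.mul_mul_conjTranspose_same V)
  have hθ := partialTrace_posSemidef (hρ.posSemidef.mul_mul_conjTranspose_same V)
  have hΓ := (gam_posSemidef (σ := σ) hρ.posSemidef).1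
  have hG := (gam_posSemidef (σ := partialTrace (V * σ * Vᴴ)) hθ).1
  refine intertwine_of_trace_eq hσ (X := 1) PosDef.one
    (by rw [suppProj_mul_gam hτ, gam_mul_suppProj hτ]) ?_
  rw [partialTrace_defect _ _ hΓ.eq hG.eq, Matrix.mul_one, Matrix.one_mul, Matrix.mul_one,
    partialTrace_dilationOp_one hσ, partialTrace_dilationOp_gam hσ, gam_mul_suppProj hτ,
    sub_add_cancel, Matrix.mul_sub, trace_sub, trace_mul_partialTrace_dilationOp hσ hV,
    trace_mul_gam_mul_gam hσ.posSemidef (by rw [suppProj_of_posDef hσ, Matrix.one_mul]),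
    trace_mul_gam_mul_gam hτ (suppProj_mul_partialTrace hσ ρ V), h, sub_self]

/-- Since D (τ^{1/2} ⊗ 1) = σ^{1/2} V*, the right side is the intertwining of the square roots with
outer factors V and τ^{1/2} ⊗ 1. Functional calculus gives one direction, squaring the other. -/
theorem intertwines_iff_sqrt (hσ : σ.PosDef) (hρ : ρ.PosDef) (hV : Vᴴ * V = 1) :
    Intertwines σ ρ V ↔
      V * psdPow σ (1 / 2) * Vᴴ *
          ((psdPow (partialTrace (V * σ * Vᴴ)) (-1 / 2) *
              psdPow (gam (partialTrace (V * σ * Vᴴ)) (partialTrace (V * ρ * Vᴴ))) (1 / 2) *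
              psdPow (partialTrace (V * σ * Vᴴ)) (1 / 2)) ⊗ₖ (1 : Matrix v v ℂ)) =
        V * psdPow (gam σ ρ) (1 / 2) * psdPow σ (1 / 2) * Vᴴ := by
  have hτ := partialTrace_posSemidef (hσ.posSemidef.mul_mul_conjTranspose_same V)
  have hθ := partialTrace_posSemidef (hρ.posSemidef.mul_mul_conjTranspose_same V)
  have hΓ := gam_posSemidef (σ := σ) hρ.posSemidef
  have hG := gam_posSemidef (σ := partialTrace (V * σ * Vᴴ)) hθ
  have hC := dilationOp_mul_kronecker_half hσ V
  have hDP := dilationOp_mul_suppProj hσ V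
  have hGP := cfc_gam_mul_suppProj hτ hθ (fun x : ℝ => x ^ (1 / 2 : ℝ))
  have hl : psdPow σ (1 / 2) * Vᴴ * ((psdPow (partialTrace (V * σ * Vᴴ)) (-1 / 2) *
      psdPow (gam (partialTrace (V * σ * Vᴴ)) (partialTrace (V * ρ * Vᴴ))) (1 / 2) *
      psdPow (partialTrace (V * σ * Vᴴ)) (1 / 2)) ⊗ₖ (1 : Matrix v v ℂ)) =
      dilationOp σ V *
        (psdPow (gam (partialTrace (V * σ * Vᴴ)) (partialTrace (V * ρ * Vᴴ))) (1 / 2) ⊗ₖ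
          (1 : Matrix v v ℂ)) *
        (psdPow (partialTrace (V * σ * Vᴴ)) (1 / 2) ⊗ₖ (1 : Matrix v v ℂ)) := by
    rw [← kronecker_one_mul_kronecker_one, ← kronecker_one_mul_kronecker_one, dilationOp]
    simp only [Matrix.mul_assoc]
  constructor
  · intro h
    have h1 := cfc_mul_of_intertwine_kronecker hΓ.1 hG.1 h (fun x : ℝ => x ^ (1 / 2 : ℝ))
    change psdPow (gam σ ρ) (1 / 2) * _ = _ * (psdPow _ (1 / 2) ⊗ₖ _) at h1
    rw [Matrix.mul_assoc V, Matrix.mul_assoc V, hl, ← h1, Matrix.mul_assoc _ (dilationOp σ V), hC]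
    simp only [Matrix.mul_assoc]
  · intro h
    set τ := partialTrace (V * σ * Vᴴ)
    set G := gam τ (partialTrace (V * ρ * Vᴴ))
    set D := dilationOp σ V with hD
    change psdPow G (1 / 2) * suppProj τ = suppProj τ * psdPow G (1 / 2) at hGP
    have h1 : D * (psdPow G (1 / 2) ⊗ₖ (1 : Matrix v v ℂ)) *
        (psdPow τ (1 / 2) ⊗ₖ (1 : Matrix v v ℂ)) =
        psdPow (gam σ ρ) (1 / 2) * D * (psdPow τ (1 / 2) ⊗ₖ (1 : Matrix v v ℂ)) := by
      calc _ = (Vᴴ * V) * (psdPow σ (1 / 2) * Vᴴ * ((psdPow τ (-1 / 2) * psdPow G (1 / 2) *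
            psdPow τ (1 / 2)) ⊗ₖ (1 : Matrix v v ℂ))) := by rw [hV, hl, Matrix.one_mul]
        _ = Vᴴ * (V * psdPow σ (1 / 2) * Vᴴ * ((psdPow τ (-1 / 2) * psdPow G (1 / 2) *
            psdPow τ (1 / 2)) ⊗ₖ (1 : Matrix v v ℂ))) := by simp only [Matrix.mul_assoc]
        _ = (Vᴴ * V) * (psdPow (gam σ ρ) (1 / 2) * (psdPow σ (1 / 2) * Vᴴ)) := by
            rw [h]; simp only [Matrix.mul_assoc]
        _ = _ := by rw [hV, Matrix.one_mul, ← hC, Matrix.mul_assoc]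
    -- Cancelling τ^{1/2} leaves the support projection, which commutes with G^{1/2} and is absorbed
    -- by D.
    have h2 : D * (psdPow G (1 / 2) ⊗ₖ (1 : Matrix v v ℂ)) = psdPow (gam σ ρ) (1 / 2) * D := by
      have h3 := congrArg (fun Z => Z * (psdPow τ (-1 / 2) ⊗ₖ (1 : Matrix v v ℂ))) h1
      simp only [Matrix.mul_assoc, kronecker_one_mul_kronecker_one] at h3
      rwa [psdPow_mul_psdPow_eq_suppProj hτ (by norm_num) (by norm_num), hDP, hGP,
        ← kronecker_one_mul_kronecker_one, ← Matrix.mul_assoc, hDP] at h3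
    change gam σ ρ * D = D * (G ⊗ₖ (1 : Matrix v v ℂ))
    rw [← psdPow_half_mul_self hΓ, ← psdPow_half_mul_self hG, Matrix.mul_assoc, ← h2,
      ← Matrix.mul_assoc, ← h2, Matrix.mul_assoc, kronecker_one_mul_kronecker_one]

/-- Multiplying the intertwining relation by τ^{1/2} ⊗ 1 on the right gives σ^{1/2} V* (τ^{-1}θ ⊗ 1)
= Γ σ^{1/2} V*; then σ^{-1/2} and V*V = 1 remove the outer factors. -/
theorem intertwines_adjoint (hσ : σ.PosDef) (hV : Vᴴ * V = 1) (h : Intertwines σ ρ V) :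
    Vᴴ * ((psdPow (partialTrace (V * σ * Vᴴ)) (-1) * partialTrace (V * ρ * Vᴴ)) ⊗ₖ
      (1 : Matrix v v ℂ)) * V = psdPow σ (-1) * ρ := by
  have hτ := partialTrace_posSemidef (hσ.posSemidef.mul_mul_conjTranspose_same V)
  have hC := dilationOp_mul_kronecker_half hσ V
  have hθP : partialTrace (V * ρ * Vᴴ) * suppProj (partialTrace (V * σ * Vᴴ)) =
      partialTrace (V * ρ * Vᴴ) := by
    rw [← partialTrace_mul_kronecker, Matrix.mul_assoc, conjTranspose_mul_suppProj hσ]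
  have hss : psdPow σ (-1 / 2) * psdPow σ (1 / 2) = 1 := by
    rw [psdPow_mul_psdPow_eq_suppProj hσ.posSemidef (by norm_num) (by norm_num),
      suppProj_of_posDef hσ]
  unfold Intertwines at h
  set τ := partialTrace (V * σ * Vᴴ)
  set θ := partialTrace (V * ρ * Vᴴ)
  have h1 : psdPow τ (-1 / 2) * θ = gam τ θ * psdPow τ (1 / 2) := by
    rw [gam, Matrix.mul_assoc, psdPow_mul_psdPow_eq_suppProj hτ (by norm_num) (by norm_num),
      Matrix.mul_assoc, hθP]
  have h2 : psdPow σ (1 / 2) * Vᴴ * ((psdPow τ (-1) * θ) ⊗ₖ (1 : Matrix v v ℂ)) =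
      gam σ ρ * (psdPow σ (1 / 2) * Vᴴ) := by
    rw [← psdPow_mul_psdPow hτ (p := -1 / 2) (q := -1 / 2) (by norm_num) (by norm_num)
      (by norm_num), Matrix.mul_assoc (psdPow τ _), h1, ← kronecker_one_mul_kronecker_one,
      ← kronecker_one_mul_kronecker_one, ← Matrix.mul_assoc, ← Matrix.mul_assoc]
    change dilationOp σ V * _ * _ = _
    rw [← h, Matrix.mul_assoc, hC]
  calc _ = psdPow σ (-1 / 2) * psdPow σ (1 / 2) *
        (Vᴴ * ((psdPow τ (-1) * θ) ⊗ₖ (1 : Matrix v v ℂ)) * V) := by rw [hss, Matrix.one_mul]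
    _ = psdPow σ (-1 / 2) * (psdPow σ (1 / 2) * Vᴴ *
        ((psdPow τ (-1) * θ) ⊗ₖ (1 : Matrix v v ℂ))) * V := by simp only [Matrix.mul_assoc]
    _ = psdPow σ (-1 / 2) * gam σ ρ * psdPow σ (1 / 2) * (Vᴴ * V) := by
        rw [h2]; simp only [Matrix.mul_assoc]
    _ = psdPow σ (-1 / 2) * psdPow σ (-1 / 2) * ρ * (psdPow σ (-1 / 2) * psdPow σ (1 / 2)) := by
        rw [hV, Matrix.mul_one]; simp only [gam, Matrix.mul_assoc]
    _ = _ := by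
        rw [hss, Matrix.mul_one,
          psdPow_mul_psdPow hσ.posSemidef (r := -1) (by norm_num) (by norm_num) (by norm_num)]

end Equality

/-! ### The dilation on the whole algebra and the adjoint channel. -/

section Channel

variable {m k v : Type*} [Fintype m] [DecidableEq m] [Fintype k] [DecidableEq k]
    [Fintype v] {M : MatrixAlgebra m} {N : MatrixAlgebra k} {T : M →ₗ[ℂ] N}
    {V : Matrix (k × v) m ℂ}

theorem four_smul_eq_polarization {A : Type*} [Ring A] [StarRing A] [Algebra ℂ A]
    [StarModule ℂ A] (X : A) :
    (4 : ℂ) • X = star (X + 1) * (X + 1) - star (X - 1) * (X - 1) +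
      Complex.I • (star (X + Complex.I • 1) * (X + Complex.I • 1)) -
      Complex.I • (star (X - Complex.I • 1) * (X - Complex.I • 1)) := by
  have hI : star (Complex.I • (1 : A)) = -(Complex.I • 1) := by
    rw [star_smul, star_one, Complex.star_def, Complex.conj_I, neg_smul]
  rw [star_add X (_ • _), star_sub X (_ • _), hI]
  -- With i·1 replaced by a central J with J² = -1, the identity becomes one of noncommutative
  -- rings.
  generalize hJ : Complex.I • (1 : A) = J
  have h1 : ∀ Y : A, Complex.I • Y = J * Y := fun Y => by rw [← hJ, smul_mul_assoc, one_mul]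
  have h2 : ∀ Y : A, Complex.I • Y = Y * J := fun Y => by rw [← hJ, mul_smul_comm, mul_one]
  have h3 : J * J = -1 := by rw [← h1, ← hJ, smul_smul, Complex.I_mul_I, neg_smul, one_smul]
  have h4 : (4 : ℂ) • X = 4 * X := by rw [← Nat.cast_ofNat, Nat.cast_smul_eq_nsmul]; simp
  have h5 : ∀ Y : A, J * Y = Y * J := fun Y => by rw [← h1, h2]
  have h6 : ∀ Y : A, Y * J * J = -Y := fun Y => by rw [mul_assoc, h3, mul_neg, mul_one]
  rw [h2, h2, h4, star_add, star_sub, star_one]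
  simp only [add_mul, mul_add, sub_mul, mul_sub, neg_mul, h6, h3, one_mul, mul_one, h5]
  noncomm_ring

/-- A linear map on a matrix algebra is determined by its values on the elements `A* A`. -/
theorem linearMap_ext_of_star_mul_self {W : Type*} [AddCommGroup W] [Module ℂ W]
    {f g : M →ₗ[ℂ] W} (h : ∀ A : M, f (star A * A) = g (star A * A)) : f = g := by
  refine LinearMap.ext fun X => ?_
  have h4 : f ((4 : ℂ) • X) = g ((4 : ℂ) • X) := by
    rw [four_smul_eq_polarization]
    simp only [map_add, map_sub, map_smul, h]
  rw [map_smul, map_smul] at h4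
  exact smul_right_injective W (by norm_num : (4 : ℂ) ≠ 0) h4

/-- The dilation formula is assumed on states only. Normalising the trace extends it to every A*A
(which is 0 if its trace is 0), and these elements span the algebra by polarization. -/
theorem IsStinespringIsometry.apply_eq (hV : IsStinespringIsometry T V) (X : M) :
    (T X : Matrix k k ℂ) = partialTrace (V * (X : Matrix m m ℂ) * Vᴴ) := by
  let f : M →ₗ[ℂ] Matrix k k ℂ :=
    { toFun := fun X => (T X : Matrix k k ℂ)
      map_add' := fun A B => by simp
      map_smul' := fun c A => by simp }
  let g : M →ₗ[ℂ] Matrix k k ℂ :=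
    { toFun := fun X => partialTrace (V * (X : Matrix m m ℂ) * Vᴴ)
      map_add' := fun A B => by simp [Matrix.mul_add, Matrix.add_mul, partialTrace_add]
      map_smul' := fun c A => by simp [partialTrace_smul] }
  have hfg : f = g := by
    refine linearMap_ext_of_star_mul_self fun A => ?_
    have hpsd : ((star A * A : M) : Matrix m m ℂ).PosSemidef :=
      posSemidef_conjTranspose_mul_self (A : Matrix m m ℂ)
    set B : M := star A * A
    by_cases h0 : (B : Matrix m m ℂ).trace = 0
    · have hB : B = 0 := Subtype.ext (hpsd.trace_eq_zero_iff.1 h0)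
      rw [hB, map_zero, map_zero]
    · set t := (B : Matrix m m ℂ).trace
      have hs : IsState (((t⁻¹ • B : M)) : Matrix m m ℂ) :=
        ⟨hpsd.smul (inv_nonneg.2 hpsd.trace_nonneg), by
          change (t⁻¹ • (B : Matrix m m ℂ)).trace = 1
          rw [trace_smul, smul_eq_mul, inv_mul_cancel₀ h0]⟩
      have h1 : f (t⁻¹ • B) = g (t⁻¹ • B) := hV.2 _ hs
      rw [map_smul, map_smul] at h1
      exact smul_right_injective _ (inv_ne_zero h0) h1
  exact LinearMap.congr_fun hfg X

/-- If `V* (Y ⊗ 1) V` lies in the algebra `M`, then it is the value of the adjoint channel. -/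
theorem IsStinespringIsometry.hsAdjoint_eq [DecidableEq v] (hV : IsStinespringIsometry T V)
    {Y : N} {Z : M}
    (h : Vᴴ * ((Y : Matrix k k ℂ) ⊗ₖ (1 : Matrix v v ℂ)) * V = Z) : hsAdjoint T Y = Z := by
  have key : ∀ X : M, ((Z : Matrix m m ℂ)ᴴ * (X : Matrix m m ℂ)).trace =
      ((hsAdjoint T Y : Matrix m m ℂ)ᴴ * (X : Matrix m m ℂ)).trace := by
    intro X
    rw [hsAdjoint_spec, hV.apply_eq, ← partialTrace_kronecker_mul, trace_partialTrace, ← h,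
      ← conjTranspose_kronecker_one, ← Matrix.mul_assoc, ← Matrix.mul_assoc, trace_mul_comm _ Vᴴ]
    simp only [conjTranspose_mul, conjTranspose_conjTranspose, Matrix.mul_assoc]
  have h0 : (((hsAdjoint T Y - Z : M) : Matrix m m ℂ)ᴴ *
      ((hsAdjoint T Y - Z : M) : Matrix m m ℂ)).trace = 0 := by
    have h1 := key (hsAdjoint T Y - Z)
    simp only [AddSubgroupClass.coe_sub, conjTranspose_sub, Matrix.sub_mul, trace_sub] at h1 ⊢
    rw [h1, sub_self]
  rw [trace_conjTranspose_mul_self_eq_zero_iff] at h0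
  exact sub_eq_zero.1 (Subtype.ext h0)

end Channel

end BSEntropy

open BSEntropy in
theorem theorem2p1 {m k v : Type*} [Fintype m] [DecidableEq m] [Fintype k] [DecidableEq k]
    [Fintype v] [DecidableEq v]
    (M : MatrixAlgebra m) (N : MatrixAlgebra k)
    (σ ρ : M)
    (hσ : IsState (σ : Matrix m m ℂ)) (hσ_pos : (σ : Matrix m m ℂ).PosDef)
    (hρ : IsState (ρ : Matrix m m ℂ)) (hρ_pos : (ρ : Matrix m m ℂ).PosDef)
    (T : M →ₗ[ℂ] N) (hT : IsQuantumChannel T)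
    (V : Matrix (k × v) m ℂ) (hV : IsStinespringIsometry T V) :
    [ bsEntropy (σ : Matrix m m ℂ) (ρ : Matrix m m ℂ) =
        bsEntropy (T σ : Matrix k k ℂ) (T ρ : Matrix k k ℂ),
      algPow σ (-1) * ρ = hsAdjoint T (algPow (T σ) (-1) * T ρ),
      V * psdPow (σ : Matrix m m ℂ) (1 / 2) * Vᴴ *
          ((psdPow (T σ : Matrix k k ℂ) (-1 / 2) *
              psdPow (gam (T σ : Matrix k k ℂ) (T ρ : Matrix k k ℂ)) (1 / 2) *
              psdPow (T σ : Matrix k k ℂ) (1 / 2)) ⊗ₖ (1 : Matrix v v ℂ)) =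
        V * psdPow (gam (σ : Matrix m m ℂ) (ρ : Matrix m m ℂ)) (1 / 2) *
          psdPow (σ : Matrix m m ℂ) (1 / 2) * Vᴴ ].TFAE := by
  have hTσ := hV.apply_eq σ
  have hTρ := hV.apply_eq ρ
  have h13 : Intertwines (σ : Matrix m m ℂ) (ρ : Matrix m m ℂ) V ↔ _ :=
    intertwines_iff_sqrt hσ_pos hρ_pos hV.1
  rw [← hTσ, ← hTρ] at h13
  tfae_have 1 → 3 := fun h => h13.1 <| by
    rw [hTσ, hTρ] at h
    exact intertwines_of_bsEntropy_eq hσ_pos hρ_pos hV.1 h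
  tfae_have 3 → 2 := fun h => (hV.hsAdjoint_eq (by
    have h1 := intertwines_adjoint hσ_pos hV.1 (h13.2 h)
    rw [← hTσ, ← hTρ] at h1
    exact h1)).symm
  -- Only the pairing of condition 2 with ρ is used: this one scalar equation already forces
  -- intertwining.
  tfae_have 2 → 1 := fun h => by
    have h1 := hsAdjoint_spec T (algPow (T σ) (-1) * T ρ) ρ
    rw [← h] at h1
    change ((psdPow (σ : Matrix m m ℂ) (-1) * (ρ : Matrix m m ℂ))ᴴ * _).trace =
      ((psdPow (T σ : Matrix k k ℂ) (-1) * (T ρ : Matrix k k ℂ))ᴴ * _).trace at h1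
    have hTρh : (T ρ : Matrix k k ℂ).IsHermitian := by
      rw [hTρ]
      exact (partialTrace_posSemidef (hρ_pos.posSemidef.mul_mul_conjTranspose_same V)).1
    rw [Matrix.conjTranspose_mul, Matrix.conjTranspose_mul, (psdPow_isHermitian _ _).eq,
      (psdPow_isHermitian _ _).eq, hρ_pos.1.eq, hTρh.eq, hTσ, hTρ] at h1
    rw [hTσ, hTρ]
    exact bsEntropy_eq_of_intertwines hσ_pos hρ_pos hV.1
      (intertwines_of_trace_eq hσ_pos hρ_pos hV.1 h1)
  tfae_finish
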